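/- A ray in a graph $G$ is a one-way infinite path in $G$; a tail of a ray is an infinite connected subgraph of it, and two rays are tail-equivalent if they share a common tail. Let $\mathcal G$ be the class of all graphs $G$ such that for every vertex $v$ of $G$ the subgraph of $G$ induced on the set of neighbours of $v$ has at most one ray up to tail-equivalence. For a cardinal $\lambda$ let $\mathcal G_\lambda$ be the set of isomorphism types of graphs in $\mathcal G$ with exactly $\lambda$ vertices. Write $G\le_w G'$ if $G$ is isomorphic to a (not necessarily induced) subgraph of $G'$. The weak complexity $\mathrm{wcp}\,\mathcal G_\lambda$ is the least cardinality of a set $D\subseteq\mathcal G_\lambda$ such that for every $G\in\mathcal G_\lambda$ there is $G'\in D$ with $G\le_w G'$. Corollary 1.9: For every regular cardinal $\lambda>\aleph_1$, $$\mathrm{wcp}\,\mathcal G_\lambda\ \ge\ \max\{\lambda^+,\,2^{\aleph_0}\}.$$ -/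

import Mathlib

open Cardinal

universe u

namespace UncountableGraphs

/-- A ray in a graph: a one-way infinite path, given by its vertices in order
`R 0, R 1, R 2, …`, all distinct, consecutive ones being adjacent. -/
structure Ray {V : Type u} (G : SimpleGraph V) where
  /-- The `n`-th vertex of the ray. -/
  vertex : ℕ → V
  injective : Function.Injective vertex
  adj : ∀ n, G.Adj (vertex n) (vertex (n + 1))

/-- `T` is a tail of the ray `R`. The infinite connected subgraphs of a ray are exactly the
rays obtained from it by deleting finitely many vertices at the beginning. -/
def Ray.IsTail {V : Type u} {G : SimpleGraph V} (T R : Ray G) : Prop :=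
  ∃ m : ℕ, ∀ n : ℕ, T.vertex n = R.vertex (m + n)

/-- Two rays are tail-equivalent if they share a common tail. -/
def Ray.TailEquivalent {V : Type u} {G : SimpleGraph V} (R R' : Ray G) : Prop :=
  ∃ T : Ray G, T.IsTail R ∧ T.IsTail R'

/-- A class of graphs (with vertex types in the universe `u`). -/
abbrev GraphClass : Type (u + 1) := (V : Type u) → SimpleGraph V → Prop

/-- The class of all graphs `G` such that, for every vertex `v`, the subgraph of `G` induced on
the neighbourhood of `v` has at most one ray up to tail-equivalence. -/
def OneRay : GraphClass.{u} := fun V G =>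
  ∀ v : V, ∀ R R' : Ray (G.induce (G.neighborSet v)), R.TailEquivalent R'

/-- The members of the class `C` whose vertex set is a fixed set of cardinality `κ`. -/
abbrev GraphClass.Member (C : GraphClass.{u}) (κ : Cardinal.{u}) : Type u :=
  {G : SimpleGraph κ.out // C _ G}

/-- Isomorphism of graphs. -/
instance GraphClass.isoSetoid (C : GraphClass.{u}) (κ : Cardinal.{u}) :
    Setoid (C.Member κ) where
  r G H := Nonempty (G.1 ≃g H.1)
  iseqv := ⟨fun _ => ⟨.refl⟩, fun ⟨e⟩ => ⟨e.symm⟩, fun ⟨e⟩ ⟨f⟩ => ⟨e.trans f⟩⟩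

/-- The set of isomorphism types of graphs of cardinality `κ` in the class `C`. -/
def GraphClass.OfCard (C : GraphClass.{u}) (κ : Cardinal.{u}) : Type u :=
  Quotient (GraphClass.isoSetoid C κ)

/-- The weak embeddability relation on isomorphism types: the first graph is isomorphic to a
(not necessarily induced) subgraph of the second. -/
def GraphClass.OfCard.WeakLE {C : GraphClass.{u}} {κ : Cardinal.{u}} (x y : C.OfCard κ) : Prop :=
  Quotient.liftOn₂ x y (fun G H => G.1.IsContained H.1)
    (fun _ _ _ _ ⟨e⟩ ⟨f⟩ => propext
      ⟨fun ⟨h⟩ => ⟨f.toCopy.comp (h.comp e.symm.toCopy)⟩,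
       fun ⟨h⟩ => ⟨f.symm.toCopy.comp (h.comp e.toCopy)⟩⟩)

/-- The weak complexity of the class `C` at the cardinal `κ`: the least cardinality of a set `D`
of members of cardinality `κ` such that every member of cardinality `κ` is weakly embeddable
in a member of `D`. -/
noncomputable def GraphClass.weakComplexity (C : GraphClass.{u}) (κ : Cardinal.{u}) :
    Cardinal.{u} :=
  sInf {c | ∃ D : Set (C.OfCard κ), #D = c ∧ ∀ x : C.OfCard κ, ∃ y ∈ D, x.WeakLE y}

/-- The class `OneRay` is closed under isomorphism. -/
theorem OneRay.of_iso {V W : Type u} {G : SimpleGraph V} {H : SimpleGraph W} (e : G ≃g H)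
    (hG : OneRay V G) : OneRay W H := by
  intro w R R'
  have key : ∀ x : H.neighborSet w, e.symm x.1 ∈ G.neighborSet (e.symm w) := fun x =>
    e.symm.map_adj_iff.2 x.2
  let f : Ray (H.induce (H.neighborSet w)) → Ray (G.induce (G.neighborSet (e.symm w))) :=
    fun Q =>
      { vertex := fun n => ⟨e.symm (Q.vertex n).1, key _⟩
        injective := fun a b hab => Q.injective (Subtype.ext (e.symm.injective
          (congrArg Subtype.val hab)))
        adj := fun n => e.symm.map_adj_iff.2 (Q.adj n) }
  have val : ∀ Q n, ((f Q).vertex n).1 = e.symm (Q.vertex n).1 := fun _ _ => rfl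
  obtain ⟨T, ⟨m, hm⟩, ⟨m', hm'⟩⟩ := hG (e.symm w) (f R) (f R')
  refine ⟨⟨fun n => R.vertex (m + n), fun a b hab => ?_, fun n => R.adj (m + n)⟩,
    ⟨m, fun _ => rfl⟩, ⟨m', fun n => ?_⟩⟩
  · exact Nat.add_left_cancel (R.injective hab)
  · apply Subtype.ext
    apply e.symm.injective
    rw [← val, ← val, ← hm, ← hm']

/-- Nothing is lost by fixing the vertex set: every graph of cardinality `κ` in the class
`OneRay` is isomorphic to one on the chosen vertex set. -/
theorem OneRay.exists_iso_member {V : Type u} {κ : Cardinal.{u}} (hV : #V = κ)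
    (G : SimpleGraph V) (hG : OneRay V G) :
    ∃ H : GraphClass.Member OneRay κ, Nonempty (G ≃g H.1) := by
  have hc : #V = #κ.out := by rw [hV, mk_out]
  obtain ⟨f⟩ := Cardinal.eq.1 hc
  exact ⟨⟨G.map f.toEmbedding, OneRay.of_iso (SimpleGraph.Iso.map f G) hG⟩,
    ⟨SimpleGraph.Iso.map f G⟩⟩

end UncountableGraphs

/-! Both bounds test a cofinal family on trees of finite sequences to which apices are added, each
joined to a chosen set of nodes. In a member of `OneRay`, every ray in the neighbourhood of a vertex
`v` shares a tail with one fixed sequence `ρ v`.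

Bound `κ⁺`: removing a final segment of `ρ v` from the neighbourhood of `v` leaves a rayless set,
and at most `κ` graphs of size `κ` produce at most `κ` such sets. The finite paths in all of them,
ordered by extension below a new top, form a well-founded relation. Join one apex to its decreasing
sequences and to one constant branch. In any copy, the constant branch occupies a tail of `ρ v`, so
the decreasing sequences are pushed into one of the rayless sets. `not_mapsTo_decreasing`
diagonalises against this.

Bound `2 ^ ℵ₀`: only `κ < 2 ^ ℵ₀` matters, since otherwise `κ⁺` is at least as large. Code a real
`x` into a subsequence of each of `κ` club-guessing ladders, and give each ladder an apex joined to
the initial segments of its subsequence. For an embedding into a graph on `κ`, the points below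
which the tree and its image correspond contain a club. A ladder inside that club lets `x` be read
off a tail of `ρ v`. Thus a graph, a ladder, a vertex and two shifts determine `x`, which forces at
least `2 ^ ℵ₀` graphs. -/

namespace UncountableGraphs

/-! ### Clubs and club guessing -/

/-- `δ` is closed under the function `f`. -/
def ClosedUnder {A : Type u} [LT A] (f : A → A) (δ : A) : Prop := ∀ α < δ, f α < δ

/-- `δ` is the strict supremum of a sequence of type `ω`. -/
def CountableCof {A : Type u} [Preorder A] (δ : A) : Prop :=
  ∃ c : ℕ → A, (∀ n, c n < δ) ∧ ∀ β < δ, ∃ n, β ≤ c n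

theorem exists_isLeast_upperBounds {A : Type u} [LinearOrder A] [WellFoundedLT A] {s : Set A}
    (hs : BddAbove s) : ∃ d, IsLUB s d :=
  ⟨WellFounded.min wellFounded_lt (upperBounds s) hs, WellFounded.min_mem _ _ hs,
    fun _ hb => not_lt.1 (WellFounded.not_lt_min wellFounded_lt _ hb)⟩

/-- There is a largest element below `α` that is closed under `f`. -/
theorem exists_greatest_closedUnder {A : Type u} [LinearOrder A] [WellFoundedLT A] (f : A → A)
    (α : A) : ∃ d, d ≤ α ∧ ClosedUnder f d ∧ ∀ β ≤ α, ClosedUnder f β → β ≤ d := by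
  obtain ⟨d, hd⟩ := exists_isLeast_upperBounds (s := {β | β ≤ α ∧ ClosedUnder f β})
    ⟨α, fun β hβ => hβ.1⟩
  refine ⟨d, hd.2 fun β hβ => hβ.1, fun γ hγ => ?_, fun β hβ h => hd.1 ⟨hβ, h⟩⟩
  obtain ⟨β, hβ, hγβ⟩ := (lt_isLUB_iff hd).1 hγ
  exact (hβ.2 γ hγβ).trans_le (hd.1 hβ)

theorem bddAbove_range_of_mk_lt {A ι : Type u} [Preorder A]
    (hA : ∀ s : Set A, #s < #A → BddAbove s) (hι : #ι < #A) (f : ι → A) :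
    BddAbove (Set.range f) :=
  hA _ (mk_range_le.trans_lt hι)

theorem bddAbove_range_nat {A : Type u} [Preorder A]
    (hA : ∀ s : Set A, #s < #A → BddAbove s) (h0 : ℵ₀ < #A) (f : ℕ → A) :
    BddAbove (Set.range f) :=
  hA _ ((Set.countable_range f).le_aleph0.trans_lt h0)

/-- The points closed under a function are unbounded. -/
theorem exists_closedUnder_gt {A : Type u} [LinearOrder A] [WellFoundedLT A] [NoMaxOrder A]
    (h0 : ℵ₀ < #A) (hIic : ∀ a : A, #(Set.Iic a) < #A)
    (hA : ∀ s : Set A, #s < #A → BddAbove s) (f : A → A) (α : A) :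
    ∃ β, α < β ∧ ClosedUnder f β := by
  have step : ∀ b : A, ∃ b', b < b' ∧ ∀ γ ≤ b, f γ < b' := fun b => by
    obtain ⟨u, hu⟩ := bddAbove_range_of_mk_lt hA (hIic b) fun γ => f γ
    obtain ⟨b', hb'⟩ := exists_gt (max b u)
    exact ⟨b', (le_max_left _ _).trans_lt hb', fun γ hγ =>
      (hu ⟨⟨γ, hγ⟩, rfl⟩).trans_lt ((le_max_right _ _).trans_lt hb')⟩
  choose g hg hfg using step
  let b : ℕ → A := fun n => g^[n] α
  have hb : ∀ n, b (n + 1) = g (b n) := fun n => Function.iterate_succ_apply' g n α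
  obtain ⟨β, hβ⟩ := exists_isLeast_upperBounds (bddAbove_range_nat hA h0 b)
  refine ⟨β, (hg α).trans_le (hβ.1 ⟨1, rfl⟩), fun γ hγ => ?_⟩
  obtain ⟨_, ⟨n, rfl⟩, hn⟩ := (lt_isLUB_iff hβ).1 hγ
  exact (hfg _ γ hn.le).trans_le (hβ.1 ⟨n + 1, hb n⟩)

/-- `δ` is a limit of points closed under `f`. -/
def IsClosedLimit {A : Type u} [LT A] (f : A → A) (δ : A) : Prop :=
  ∀ β < δ, ∃ ε, ClosedUnder f ε ∧ β < ε ∧ ε < δ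

/-- The supremum of a strictly increasing `ω`-sequence of closed points has both properties. -/
theorem exists_isClosedLimit {A : Type u} [LinearOrder A] [WellFoundedLT A] [NoMaxOrder A]
    (h0 : ℵ₀ < #A) (hIic : ∀ a : A, #(Set.Iic a) < #A)
    (hA : ∀ s : Set A, #s < #A → BddAbove s) (f : A → A) :
    ∃ δ, CountableCof δ ∧ IsClosedLimit f δ := by
  have : Nonempty A := mk_ne_zero_iff.1 (aleph0_pos.trans h0).ne'
  choose g hg hfg using exists_closedUnder_gt h0 hIic hA f
  let b : ℕ → A := fun n => g^[n + 1] (Classical.arbitrary A)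
  have hb : ∀ n, b (n + 1) = g (b n) := fun n => Function.iterate_succ_apply' g _ _
  have hlt : ∀ n, b n < b (n + 1) := fun n => hb n ▸ hg _
  have hcl : ∀ n, ClosedUnder f (b n) := fun n => by
    have : b n = g (g^[n] (Classical.arbitrary A)) := Function.iterate_succ_apply' g _ _
    exact this ▸ hfg _
  obtain ⟨δ, hδ⟩ := exists_isLeast_upperBounds (bddAbove_range_nat hA h0 b)
  have hbδ : ∀ n, b n < δ := fun n => (hlt n).trans_le (hδ.1 ⟨n + 1, rfl⟩)
  have key : ∀ β < δ, ∃ n, β < b n := fun β hβ => by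
    obtain ⟨_, ⟨n, rfl⟩, hn⟩ := (lt_isLUB_iff hδ).1 hβ
    exact ⟨n, hn⟩
  exact ⟨δ, ⟨b, hbδ, fun β hβ => (key β hβ).imp fun _ => le_of_lt⟩, fun β hβ =>
    let ⟨n, hn⟩ := key β hβ
    ⟨b n, hcl n, hn, hbδ n⟩⟩

/-- Club guessing at points of countable cofinality, for an order `A` of regular type above the
type of an order `B` in which countable sets are bounded. The closed unbounded sets are given as
the sets of points closed under a function. -/
theorem exists_club_guessing {A B : Type u} [LinearOrder A] [WellFoundedLT A] [NoMaxOrder A]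
    [LinearOrder B] [WellFoundedLT B] [NoMaxOrder B] [Nonempty B]
    (h0 : ℵ₀ < #A) (hIic : ∀ a : A, #(Set.Iic a) < #A)
    (hA : ∀ s : Set A, #s < #A → BddAbove s) (hBA : #B < #A)
    (hB : ∀ f : ℕ → B, BddAbove (Set.range f)) :
    ∃ c : A → ℕ → A, (∀ i, StrictMono (c i)) ∧
      ∀ g : A → A, ∃ i, ∀ n, ClosedUnder g (c i n) := by
  have : Nonempty A := mk_ne_zero_iff.1 (aleph0_pos.trans h0).ne'
  have hC : ∀ δ : A, ∃ c : ℕ → A, CountableCof δ →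
      (∀ n, c n < δ) ∧ ∀ β < δ, ∃ n, β ≤ c n := fun δ => by
    by_cases h : CountableCof δ
    · exact h.imp fun c hc _ => hc
    · exact ⟨fun _ => δ, fun h' => absurd h' h⟩
  choose C hC using hC
  choose drop drop_le drop_closed le_drop using exists_greatest_closedUnder (A := A)
  have main : ∃ f : A → A, ∀ g : A → A, ∃ δ, CountableCof δ ∧ IsClosedLimit f δ ∧
      ∀ n, ClosedUnder g (drop f (C δ n)) := by
    -- If each `f` is refuted by some `G f`, iterate along `B`: `F i` dominates `F j` and `G (F j)`
    -- for all `j < i`, so the sets of closed points shrink.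
    by_contra! hcon
    choose G hG using hcon
    have hU : ∀ s : Set A, ∃ u, BddAbove s → u ∈ upperBounds s := fun s => by
      by_cases h : BddAbove s
      · exact h.imp fun u hu _ => hu
      · exact ⟨Classical.arbitrary A, fun h' => absurd h' h⟩
    choose U hU using hU
    let H : ∀ i : B, (∀ j, j < i → A → A) → A → A := fun i F α =>
      U (Set.range fun j : Set.Iio i => max (F j j.2 α) (G (F j j.2) α))
    let F : B → A → A := wellFounded_lt.fix H
    have hF : ∀ i α, F i α = U (Set.range fun j : Set.Iio i => max (F j α) (G (F j) α)) :=
      fun i α => congrFun (wellFounded_lt.fix_eq H i) α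
    have hFle : ∀ i j, j < i → ∀ α, F j α ≤ F i α ∧ G (F j) α ≤ F i α := fun i j hj α => by
      rw [hF i]
      exact max_le_iff.1 (hU _ (bddAbove_range_of_mk_lt hA ((mk_set_le _).trans_lt hBA) _)
        ⟨⟨j, hj⟩, rfl⟩)
    have hclosed : ∀ {f g : A → A}, (∀ α, f α ≤ g α) → ∀ δ, ClosedUnder g δ → ClosedUnder f δ :=
      fun hfg δ h α hα => (hfg α).trans_lt (h α hα)
    have hmono : ∀ i j, j ≤ i → ∀ α, F j α ≤ F i α := fun i j hj α => by
      rcases hj.eq_or_lt with rfl | hj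
      · exact le_rfl
      · exact (hFle i j hj α).1
    let f : A → A := fun α => U (Set.range fun i => F i α)
    have hf : ∀ i α, F i α ≤ f α := fun i α =>
      hU _ (bddAbove_range_of_mk_lt hA hBA _) ⟨i, rfl⟩
    obtain ⟨δ, hδ, hlim⟩ := exists_isClosedLimit h0 hIic hA f
    have hanti : ∀ α, Antitone fun i => drop (F i) α := fun α j i hj =>
      le_drop _ _ _ (drop_le _ _) (hclosed (hmono i j hj) _ (drop_closed _ _))
    -- For fixed `n` the drops decrease with the index in a well-order, so they stabilise;
    -- boundedness of countable sets in `B` then gives one index for all `n`.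
    have hstable : ∀ n, ∃ i, ∀ j, i ≤ j → drop (F j) (C δ n) = drop (F i) (C δ n) := fun n => by
      obtain ⟨_, ⟨i, rfl⟩, hi⟩ := wellFounded_lt.has_min
        (Set.range fun i => drop (F i) (C δ n)) (Set.range_nonempty _)
      exact ⟨i, fun j hj => (hanti _ hj).antisymm (not_lt.1 (hi _ ⟨j, rfl⟩))⟩
    choose I hI using hstable
    obtain ⟨i, hi⟩ := hB I
    obtain ⟨j, hij⟩ := exists_gt i
    obtain ⟨n, hn⟩ := hG (F i) δ hδ fun β hβ =>
      (hlim β hβ).imp fun ε hε => ⟨hclosed (hf i) _ hε.1, hε.2⟩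
    refine hn ?_
    -- The stable value is also the drop for the later `F j`, which dominates `G (F i)`. So it is
    -- closed under `G (F i)`, against the choice of `G`.
    rw [hI n i (hi ⟨n, rfl⟩), ← hI n j ((hi ⟨n, rfl⟩).trans hij.le)]
    exact hclosed (fun α => (hFle j i hij α).2) _ (drop_closed _ _)
  obtain ⟨f, hf⟩ := main
  have hc : ∀ δ : A, ∃ c : ℕ → A, StrictMono c ∧ (CountableCof δ → IsClosedLimit f δ →
      ∀ n, ∃ k, c n = drop f (C δ k)) := fun δ => by
    by_cases h : CountableCof δ ∧ IsClosedLimit f δ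
    · obtain ⟨hlt, hcof⟩ := hC δ h.1
      let s := Set.range fun n => drop f (C δ n)
      have : Nonempty s := ⟨⟨_, 0, rfl⟩⟩
      -- A closed point `ε` strictly between a drop and `δ` lies below some `C δ k`, whose drop is
      -- then at least `ε`.
      have : NoMaxOrder s := ⟨by
        rintro ⟨_, n, rfl⟩
        obtain ⟨ε, hε, hlt', hεδ⟩ := h.2 _ ((drop_le f (C δ n)).trans_lt (hlt n))
        obtain ⟨k, hk⟩ := hcof ε hεδ
        exact ⟨⟨_, k, rfl⟩, hlt'.trans_le (le_drop _ _ _ hk hε)⟩⟩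
      obtain ⟨c, hc⟩ := Nat.exists_strictMono s
      exact ⟨fun n => c n, fun _ _ hab => hc hab, fun _ _ n =>
        let ⟨k, hk⟩ := (c n).2
        ⟨k, hk.symm⟩⟩
    · obtain ⟨c, hc⟩ := Nat.exists_strictMono A
      exact ⟨c, hc, fun h1 h2 => absurd ⟨h1, h2⟩ h⟩
  choose c hc hcd using hc
  refine ⟨c, hc, fun g => ?_⟩
  obtain ⟨δ, h1, h2, h3⟩ := hf g
  exact ⟨δ, fun n => let ⟨k, hk⟩ := hcd δ h1 h2 n; hk ▸ h3 k⟩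

/-! ### Trees of finite sequences with apices -/

/-- Adjacency in the tree of finite sequences: one sequence extends the other by one entry. -/
def TreeAdj {L : Type u} (l l' : List L) : Prop := (∃ a, l' = a :: l) ∨ ∃ a, l = a :: l'

theorem TreeAdj.symm {L : Type u} {l l' : List L} (h : TreeAdj l l') : TreeAdj l' l := Or.symm h

theorem TreeAdj.length {L : Type u} {l l' : List L} (h : TreeAdj l l') :
    l'.length = l.length + 1 ∨ l.length = l'.length + 1 := by
  rcases h with ⟨a, rfl⟩ | ⟨a, rfl⟩ <;> simp

/-- A ray in the tree of finite sequences. -/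
def IsTreeRay {L : Type u} (f : ℕ → List L) : Prop :=
  Function.Injective f ∧ ∀ n, TreeAdj (f n) (f (n + 1))

/-- A ray in the tree of finite sequences eventually moves away from the root. -/
theorem IsTreeRay.eventually_cons {L : Type u} {f : ℕ → List L} (hf : IsTreeRay f) :
    ∃ k, ∀ n, ∃ a, f (k + n + 1) = a :: f (k + n) := by
  -- Lengths cannot decrease forever. After one step up, stepping down would revisit the unique
  -- parent, against injectivity.
  have hup : ∃ k, ∃ a, f (k + 1) = a :: f k := by
    by_contra! h
    have hdown : ∀ n, (f n).length + n = (f 0).length := fun n => by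
      induction n with
      | zero => rfl
      | succ n ih =>
        rcases hf.2 n with ⟨a, ha⟩ | ⟨a, ha⟩
        · exact absurd ha (h n a)
        · rw [ha, List.length_cons] at ih
          omega
    have := hdown ((f 0).length + 1)
    omega
  obtain ⟨k, hk⟩ := hup
  refine ⟨k, fun n => ?_⟩
  induction n with
  | zero => exact hk
  | succ n ih =>
    obtain ⟨a, ha⟩ := ih
    rcases hf.2 (k + n + 1) with h | ⟨b, hb⟩
    · exact h
    · rw [ha, List.cons.injEq] at hb
      have := hf.1 hb.2
      omega

/-- The tree of finite sequences together with apices, where the apex `i` is joined to all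
sequences in `S i`. -/
def apexGraph {L I : Type u} (S : I → Set (List L)) : SimpleGraph (List L ⊕ I) where
  Adj
    | .inl l, .inl l' => TreeAdj l l'
    | .inl l, .inr i => l ∈ S i
    | .inr i, .inl l => l ∈ S i
    | .inr _, .inr _ => False
  symm := ⟨by
    rintro (l | i) (l' | j) h
    · exact h.symm
    · exact h
    · exact h
    · exact h⟩
  loopless := ⟨by
    rintro (l | i) h
    · have := h.length
      omega
    · exact h⟩

section
variable {L I : Type u} {S : I → Set (List L)}

theorem apexGraph_adj_inl_inl {l l' : List L} :
    (apexGraph S).Adj (.inl l) (.inl l') ↔ TreeAdj l l' := Iff.rfl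

theorem apexGraph_adj_inr_inl {l : List L} {i : I} :
    (apexGraph S).Adj (.inr i) (.inl l) ↔ l ∈ S i := Iff.rfl

theorem apexGraph_not_adj_inr_inr {i j : I} : ¬ (apexGraph S).Adj (.inr i) (.inr j) := id

/-- A ray in the neighbourhood of a sequence alternates between sequences and apices. -/
theorem apexGraph_ray_alternates {l : List L}
    (R : Ray ((apexGraph S).induce ((apexGraph S).neighborSet (.inl l)))) :
    ∃ (q : ℕ → List L) (i : ℕ → I), Function.Injective q ∧ Function.Injective i ∧
      (∀ n, TreeAdj l (q n)) ∧ (∀ n, q n ∈ S (i n)) ∧ ∀ n, q (n + 1) ∈ S (i n) := by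
  let u : ℕ → List L ⊕ I := fun n => (R.vertex n).1
  have hinj : Function.Injective u := fun a b hab => R.injective (Subtype.ext hab)
  have hadj : ∀ n, (apexGraph S).Adj (u n) (u (n + 1)) := R.adj
  have hl : ∀ n, (apexGraph S).Adj (.inl l) (u n) := fun n => (R.vertex n).2
  -- Adjacent sequences differ in parity of length, so two neighbours of `l` in the tree are never
  -- adjacent.
  have hA : ∀ n q, u n = .inl q → ∃ i, u (n + 1) = .inr i := fun n q hq => by
    rcases h : u (n + 1) with q' | i
    · have h1 := hl n
      have h2 := hl (n + 1)
      have h3 := hadj n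
      rw [hq] at h1 h3
      rw [h] at h2 h3
      rw [apexGraph_adj_inl_inl] at h1 h2 h3
      have := h1.length
      have := h2.length
      have := h3.length
      omega
    · exact ⟨i, rfl⟩
  have hB : ∀ n i, u n = .inr i → ∃ q, u (n + 1) = .inl q := fun n i hi => by
    rcases h : u (n + 1) with q | j
    · exact ⟨q, rfl⟩
    · have h3 := hadj n
      rw [hi, h] at h3
      exact absurd h3 apexGraph_not_adj_inr_inr
  have hstart : ∃ k q, u k = .inl q := by
    rcases h : u 0 with q | i
    · exact ⟨0, q, h⟩
    · exact ⟨1, hB 0 i h⟩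
  obtain ⟨k, q0, hk⟩ := hstart
  have heven : ∀ n, ∃ q, u (k + 2 * n) = .inl q := fun n => by
    induction n with
    | zero => exact ⟨q0, hk⟩
    | succ n ih =>
      obtain ⟨q, hq⟩ := ih
      obtain ⟨i, hi⟩ := hA _ _ hq
      exact hB _ _ hi
  choose q hq using heven
  choose i hi using fun n => hA _ _ (hq n)
  refine ⟨q, i, fun a b hab => ?_, fun a b hab => ?_, fun n => ?_, fun n => ?_, fun n => ?_⟩
  · have := hinj ((hq a).trans ((congrArg Sum.inl hab).trans (hq b).symm))
    omega
  · have := hinj ((hi a).trans ((congrArg Sum.inr hab).trans (hi b).symm))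
    omega
  · have := hl (k + 2 * n)
    rwa [hq] at this
  · have := hadj (k + 2 * n)
    rwa [hq, hi] at this
  · have := hadj (k + 2 * n + 1)
    rw [hi, show k + 2 * n + 1 + 1 = k + 2 * (n + 1) by ring, hq] at this
    exact this

/-- The neighbourhood of a sequence is rayless if every apex is joined to at most one child of
every sequence. -/
theorem apexGraph_isEmpty_ray_of_unique_child
    (hS : ∀ i a b l, a :: l ∈ S i → b :: l ∈ S i → a = b) (l : List L) :
    IsEmpty (Ray ((apexGraph S).induce ((apexGraph S).neighborSet (.inl l)))) := ⟨fun R => by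
  obtain ⟨q, i, hq, -, hl, h1, h2⟩ := apexGraph_ray_alternates R
  -- Two consecutive sequences share an apex, so they are not both children of `l`. One of them is
  -- the parent, which a ray can visit only once.
  have hparent : ∀ n, (∃ a, l = a :: q n) ∨ ∃ a, l = a :: q (n + 1) := fun n => by
    rcases hl n with ⟨a, ha⟩ | h
    · rcases hl (n + 1) with ⟨b, hb⟩ | h
      · have h3 := h1 n
        have h4 := h2 n
        rw [ha] at h3
        rw [hb] at h4
        have := hq (ha.trans ((congrArg (· :: l) (hS _ _ _ _ h3 h4)).trans hb.symm))
        omega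
      · exact Or.inr h
    · exact Or.inl h
  have huniq : ∀ m n, (∃ a, l = a :: q m) → (∃ a, l = a :: q n) → m = n := by
    rintro m n ⟨a, ha⟩ ⟨b, hb⟩
    exact hq (List.cons.inj (ha.symm.trans hb)).2
  rcases hparent 0 with h | h <;> rcases hparent 2 with h' | h' <;>
    · have := huniq _ _ h h'
      omega⟩

theorem apexGraph_isEmpty_ray_of_subsingleton [Subsingleton I] (l : List L) :
    IsEmpty (Ray ((apexGraph S).induce ((apexGraph S).neighborSet (.inl l)))) := ⟨fun R => by
  obtain ⟨-, i, -, hi, -⟩ := apexGraph_ray_alternates R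
  exact zero_ne_one (hi (Subsingleton.elim (i 0) (i 1)))⟩

theorem exists_isTreeRay_of_ray {i : I}
    (R : Ray ((apexGraph S).induce ((apexGraph S).neighborSet (.inr i)))) :
    ∃ f : ℕ → List L, IsTreeRay f ∧ (∀ n, f n ∈ S i) ∧ ∀ n, (R.vertex n).1 = .inl (f n) := by
  have h : ∀ n, ∃ l, (R.vertex n).1 = .inl l := fun n => by
    have h1 : (apexGraph S).Adj (.inr i) (R.vertex n).1 := (R.vertex n).2
    rcases h : (R.vertex n).1 with l | j
    · exact ⟨l, rfl⟩
    · rw [h] at h1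
      exact absurd h1 apexGraph_not_adj_inr_inr
  choose f hf using h
  refine ⟨f, ⟨fun a b hab => R.injective (Subtype.ext ?_), fun n => ?_⟩, fun n => ?_, hf⟩
  · rw [hf, hf, hab]
  · have : (apexGraph S).Adj (R.vertex n).1 (R.vertex (n + 1)).1 := R.adj n
    rwa [hf, hf] at this
  · have h1 : (apexGraph S).Adj (.inr i) (R.vertex n).1 := (R.vertex n).2
    rwa [hf] at h1

theorem oneRay_apexGraph
    (hrayless : ∀ l, IsEmpty (Ray ((apexGraph S).induce ((apexGraph S).neighborSet (.inl l)))))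
    (hS : ∀ i f f', IsTreeRay f → IsTreeRay f' → (∀ n, f n ∈ S i) → (∀ n, f' n ∈ S i) →
      ∃ m m', ∀ n, f (m + n) = f' (m' + n)) : OneRay _ (apexGraph S) := by
  rintro (l | i) R R'
  · exact ((hrayless l).false R).elim
  · obtain ⟨f, hf, hfS, hfR⟩ := exists_isTreeRay_of_ray R
    obtain ⟨f', hf', hfS', hfR'⟩ := exists_isTreeRay_of_ray R'
    obtain ⟨m, m', h⟩ := hS i f f' hf hf' hfS hfS'
    refine ⟨⟨fun n => R.vertex (m + n), fun a b hab => Nat.add_left_cancel (R.injective hab),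
      fun n => R.adj (m + n)⟩, ⟨m, fun _ => rfl⟩, ⟨m', fun n => Subtype.ext ?_⟩⟩
    change (R.vertex (m + n)).1 = _
    rw [hfR, hfR', h]

end

/-! ### Apices joined to branches -/

/-- The finite initial segments of a sequence, with the entries in reverse order. -/
def prefixes {L : Type u} (s : ℕ → L) : ℕ → List L
  | 0 => []
  | n + 1 => s n :: prefixes s n

theorem length_prefixes {L : Type u} (s : ℕ → L) (n : ℕ) : (prefixes s n).length = n := by
  induction n with
  | zero => rfl
  | succ n ih => rw [prefixes, List.length_cons, ih]

theorem mem_prefixes {L : Type u} {s : ℕ → L} {n : ℕ} {a : L} (h : a ∈ prefixes s n) :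
    ∃ k < n, s k = a := by
  induction n with
  | zero => simp [prefixes] at h
  | succ n ih =>
    rcases List.mem_cons.1 h with rfl | h
    · exact ⟨n, n.lt_succ_self, rfl⟩
    · obtain ⟨k, hk, rfl⟩ := ih h
      exact ⟨k, hk.trans n.lt_succ_self, rfl⟩

/-- Two tree rays whose vertices eventually are determined by their lengths share a tail. -/
theorem IsTreeRay.exists_common_tail {L : Type u} {f f' : ℕ → List L} (hf : IsTreeRay f)
    (hf' : IsTreeRay f') (p : ℕ → List L) {k k' : ℕ}
    (hp : ∀ n, f (k + n) = p (f (k + n)).length) (hp' : ∀ n, f' (k' + n) = p (f' (k' + n)).length) :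
    ∃ m m', ∀ n, f (m + n) = f' (m' + n) := by
  have len : ∀ {g : ℕ → List L} {j : ℕ}, (∀ n, ∃ a, g (j + n + 1) = a :: g (j + n)) →
      ∀ n, (g (j + n)).length = (g j).length + n := fun h n => by
    induction n with
    | zero => rfl
    | succ n ih =>
      obtain ⟨a, ha⟩ := h n
      rw [← add_assoc, ha, List.length_cons, ih, add_assoc]
  obtain ⟨j, hj⟩ := hf.eventually_cons
  obtain ⟨j', hj'⟩ := hf'.eventually_cons
  have h1 := len hj
  have h2 := len hj'
  -- Past `j` and `j'` the lengths grow by one per step. Shifting each ray by the other's starting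
  -- length aligns them; adding `k + k'` puts both where `p` applies.
  refine ⟨j + ((f' j').length + k + k'), j' + ((f j).length + k + k'), fun n => ?_⟩
  have e1 := hp (j + (f' j').length + k' + n)
  have e2 := hp' (j' + (f j).length + k + n)
  rw [show k + (j + (f' j').length + k' + n) = j + ((f' j').length + k + k' + n) by ring,
    h1] at e1
  rw [show k' + (j' + (f j).length + k + n) = j' + ((f j).length + k + k' + n) by ring,
    h2] at e2
  rw [add_assoc j, add_assoc j', e1, e2]
  congr 1
  ring

/-- The tree in which every apex `i` is joined to the initial segments of a sequence `s i`. -/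
abbrev branchGraph {L I : Type u} (s : I → ℕ → L) : SimpleGraph (List L ⊕ I) :=
  apexGraph fun i => Set.range (prefixes (s i))

theorem oneRay_branchGraph {L I : Type u} (s : I → ℕ → L) : OneRay _ (branchGraph s) := by
  have hmem : ∀ {i l}, l ∈ Set.range (prefixes (s i)) → l = prefixes (s i) l.length := by
    rintro i _ ⟨n, rfl⟩
    rw [length_prefixes]
  refine oneRay_apexGraph (apexGraph_isEmpty_ray_of_unique_child fun i a b l ha hb => ?_)
    fun i f f' hf hf' h h' => hf.exists_common_tail hf' (prefixes (s i)) (k := 0) (k' := 0)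
      (fun n => hmem (h _)) fun n => hmem (h' _)
  have h := (hmem ha).trans (hmem hb).symm
  exact (List.cons.inj h).1

/-! ### Common tails and cofinal families -/

/-- In a member of `OneRay`, one can choose sequences `ρ v` such that every ray in the
neighbourhood of `v` has a tail in common with `ρ v`. -/
theorem OneRay.exists_common_tail {V : Type u} {G : SimpleGraph V} (hG : OneRay V G) :
    ∃ ρ : V → ℕ → V, ∀ v (f : ℕ → V), Function.Injective f → (∀ n, G.Adj (f n) (f (n + 1))) →
      (∀ n, G.Adj v (f n)) → ∃ m m', ∀ n, f (m + n) = ρ v (m' + n) := by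
  have h : ∀ v, ∃ ρ : ℕ → V, ∀ f : ℕ → V, Function.Injective f →
      (∀ n, G.Adj (f n) (f (n + 1))) → (∀ n, G.Adj v (f n)) →
      ∃ m m', ∀ n, f (m + n) = ρ (m' + n) := fun v => by
    by_cases hv : Nonempty (Ray (G.induce (G.neighborSet v)))
    · obtain ⟨Q⟩ := hv
      refine ⟨fun n => (Q.vertex n).1, fun f hf hadj hv => ?_⟩
      let R : Ray (G.induce (G.neighborSet v)) :=
        ⟨fun n => ⟨f n, hv n⟩, fun a b hab => hf (congrArg Subtype.val hab), hadj⟩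
      obtain ⟨T, ⟨m, hm⟩, ⟨m', hm'⟩⟩ := hG v R Q
      exact ⟨m, m', fun n => congrArg Subtype.val ((hm n).symm.trans (hm' n))⟩
    · exact ⟨fun _ => v, fun f hf hadj hv' =>
        absurd ⟨⟨fun n => ⟨f n, hv' n⟩, fun a b hab => hf (congrArg Subtype.val hab), hadj⟩⟩ hv⟩
  choose ρ hρ using h
  exact ⟨ρ, hρ⟩

/-- The weak complexity is attained by a family of graphs. -/
theorem OneRay.exists_family_of_weakComplexity (κ : Cardinal.{u}) :
    ∃ (J : Type u) (G : J → GraphClass.Member OneRay κ),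
      #J = GraphClass.weakComplexity OneRay κ ∧ ∀ (V : Type u) (H : SimpleGraph V), #V = κ →
        OneRay V H → ∃ j, H.IsContained (G j).1 := by
  have hrefl : ∀ x : GraphClass.OfCard OneRay κ, x.WeakLE x := fun x => by
    induction x using Quotient.inductionOn with
    | h G => exact ⟨.id _⟩
  obtain ⟨D, hD, hdom⟩ := csInf_mem (s := {c | ∃ D : Set (GraphClass.OfCard OneRay κ), #D = c ∧
    ∀ x : GraphClass.OfCard OneRay κ, ∃ y ∈ D, x.WeakLE y})
    ⟨_, Set.univ, rfl, fun x => ⟨x, trivial, hrefl x⟩⟩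
  refine ⟨D, fun y => y.1.out, hD, fun V H hV hH => ?_⟩
  obtain ⟨H', ⟨e⟩⟩ := OneRay.exists_iso_member hV H hH
  obtain ⟨y, hy, hle⟩ := hdom (Quotient.mk _ H')
  refine ⟨⟨y, hy⟩, ?_⟩
  rw [← y.out_eq] at hle
  obtain ⟨φ⟩ := hle
  exact ⟨φ.comp e.toCopy⟩

/-! ### The bound `κ⁺`: diagonalising against rayless sets -/

/-- The path `t` in `N` extends the path `s` by one vertex. -/
def PathExtends {V : Type u} (G : SimpleGraph V) (N : Set V) (t s : List V) : Prop :=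
  (∃ a, t = a :: s) ∧ t.IsChain G.Adj ∧ t.Nodup ∧ ∀ x ∈ t, x ∈ N

/-- There is no ray of `G` in the set `N`. -/
def RaylessOn {V : Type u} (G : SimpleGraph V) (N : Set V) : Prop :=
  ∀ f : ℕ → V, Function.Injective f → (∀ n, G.Adj (f n) (f (n + 1))) → ¬ ∀ n, f n ∈ N

/-- The vertices added at successive extensions would form a ray in `N`. -/
theorem RaylessOn.not_descending {V : Type u} {G : SimpleGraph V} {N : Set V}
    (h : RaylessOn G N) (t : ℕ → List V) : ¬ ∀ n, PathExtends G N (t (n + 1)) (t n) := by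
  intro ht
  choose a ha using fun n => (ht n).1
  have hmem : ∀ m n, m < n → a m ∈ t n := fun m n hmn => by
    induction n, hmn using Nat.le_induction with
    | base => rw [ha]; exact List.mem_cons_self
    | succ n _ ih => rw [ha]; exact List.mem_cons_of_mem _ ih
  have hne : ∀ m n, m < n → a m ≠ a n := fun m n hmn he => by
    have := (ht n).2.2.1
    rw [ha, List.nodup_cons] at this
    exact this.1 (he ▸ hmem m n hmn)
  refine h a (fun m n hmn => ?_) (fun n => ?_) fun n => ?_
  · by_contra hc
    rcases Nat.lt_or_gt_of_ne hc with hc | hc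
    · exact hne _ _ hc hmn
    · exact hne _ _ hc hmn.symm
  · have := (ht (n + 1)).2.1
    rw [ha, ha, List.isChain_cons_cons] at this
    exact this.1.symm
  · exact (ht n).2.2.2 _ (by rw [ha]; exact List.mem_cons_self)

section
variable {J V : Type u}

/-- The disjoint union of the extension relations for a family of graphs, with a new top
element. -/
def FamilyExtends (G : J → SimpleGraph V) (N : J → Set V) : Option (J × List V) →
    Option (J × List V) → Prop
  | some (i, t), some (j, s) => i = j ∧ PathExtends (G j) (N j) t s
  | some _, none => True
  | none, _ => False

theorem FamilyExtends.not_descending {G : J → SimpleGraph V} {N : J → Set V}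
    (h : ∀ j, RaylessOn (G j) (N j)) (a : ℕ → Option (J × List V)) :
    ¬ ∀ n, FamilyExtends G N (a (n + 1)) (a n) := by
  intro ha
  have hsome : ∀ n, ∃ i t, a (n + 1) = some (i, t) := fun n => by
    rcases hn : a (n + 1) with _ | ⟨i, t⟩
    · have := ha n
      rw [hn] at this
      exact this.elim
    · exact ⟨i, t, rfl⟩
  choose i t hit using hsome
  have hstep : ∀ n, i (n + 1) = i n ∧ PathExtends (G (i n)) (N (i n)) (t (n + 1)) (t n) :=
    fun n => by
      have := ha (n + 1)
      rw [hit, hit] at this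
      exact this
  have hconst : ∀ n, i n = i 0 := fun n => by
    induction n with
    | zero => rfl
    | succ n ih => rw [(hstep n).1, ih]
  exact (h (i 0)).not_descending t fun n => hconst n ▸ (hstep n).2

end

/-- The set of decreasing finite sequences for a relation `r` together with a constant branch. -/
def decreasingOrConstant {L : Type u} (r : L → L → Prop) (z : L) : Set (List L) :=
  {l | l.IsChain r} ∪ Set.range fun n => List.replicate (n + 2) z

/-- A ray climbing through decreasing sequences forever would give an infinite `r`-descent. Once a
sequence is not a chain, no extension of it is, so the ray ends in the constant branch. -/
theorem oneRay_decreasing {L : Type u} {r : L → L → Prop}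
    (hr : ∀ a : ℕ → L, ¬ ∀ n, r (a (n + 1)) (a n)) (z : L) :
    OneRay _ (apexGraph fun _ : PUnit.{u + 1} => decreasingOrConstant r z) := by
  have key : ∀ f, IsTreeRay f → (∀ n, f n ∈ decreasingOrConstant r z) →
      ∃ k, ∀ n, f (k + n) = List.replicate (f (k + n)).length z := fun f hf hfS => by
    obtain ⟨k, hk⟩ := hf.eventually_cons
    have hex : ∃ n, ¬ (f (k + n)).IsChain r := by
      by_contra! hall
      choose a ha using hk
      refine hr a fun n => ?_
      have := hall (n + 1 + 1)
      rw [← add_assoc, ha, ← add_assoc, ha, List.isChain_cons_cons] at this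
      exact this.1
    obtain ⟨m, hm⟩ := hex
    have hnot : ∀ n, ¬ (f (k + (m + n))).IsChain r := fun n => by
      induction n with
      | zero => exact hm
      | succ n ih =>
        obtain ⟨a, ha⟩ := hk (m + n)
        rw [← add_assoc, ← add_assoc, add_assoc k, ha]
        exact fun h => ih h.of_cons
    refine ⟨k + m, fun n => ?_⟩
    obtain ⟨j, hj⟩ := (hfS (k + m + n)).resolve_left (by rw [add_assoc]; exact hnot n)
    rw [← hj]
    simp
  refine oneRay_apexGraph apexGraph_isEmpty_ray_of_subsingleton fun i f f' hf hf' h h' => ?_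
  obtain ⟨k, hk⟩ := key f hf h
  obtain ⟨k', hk'⟩ := key f' hf' h'
  exact hf.exists_common_tail hf' (fun n => List.replicate n z) hk hk'

/-- The images of the nonempty final segments of a list. -/
def mapSuffixes {L V : Type u} (g : List L → V) : List L → List V
  | [] => []
  | a :: l => g (a :: l) :: mapSuffixes g l

section
variable {L V : Type u} {g : List L → V}

theorem mem_mapSuffixes {l : List L} {x : V} (h : x ∈ mapSuffixes g l) :
    ∃ l', l' <:+ l ∧ g l' = x := by
  induction l with
  | nil => simp [mapSuffixes] at h
  | cons a l ih =>
    rcases List.mem_cons.1 h with rfl | h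
    · exact ⟨_, List.suffix_rfl, rfl⟩
    · obtain ⟨l', h1, h2⟩ := ih h
      exact ⟨l', h1.trans (List.suffix_cons a l), h2⟩

theorem nodup_mapSuffixes (hg : Function.Injective g) (l : List L) : (mapSuffixes g l).Nodup := by
  induction l with
  | nil => exact List.nodup_nil
  | cons a l ih =>
    refine List.nodup_cons.2 ⟨fun h => ?_, ih⟩
    obtain ⟨l', h1, h2⟩ := mem_mapSuffixes h
    have := h1.length_le
    rw [hg h2, List.length_cons] at this
    omega

theorem isChain_mapSuffixes {G : SimpleGraph V}
    (hg : ∀ l l', TreeAdj l l' → G.Adj (g l) (g l')) (l : List L) :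
    (mapSuffixes g l).IsChain G.Adj := by
  induction l with
  | nil => exact List.isChain_nil
  | cons a l ih =>
    cases l with
    | nil => exact List.isChain_singleton _
    | cons b l => exact List.isChain_cons_cons.2 ⟨hg _ _ (Or.inr ⟨a, rfl⟩), ih⟩

end

/-- The tree of decreasing sequences for the extension relation of a family of rayless sets does
not embed into any of these sets. -/
theorem not_mapsTo_decreasing {J V : Type u} {G : J → SimpleGraph V} {N : J → Set V}
    (h : ∀ j, RaylessOn (G j) (N j)) (j : J) (g : List (Option (J × List V)) → V)
    (hinj : Function.Injective g) (hadj : ∀ l l', TreeAdj l l' → (G j).Adj (g l) (g l')) :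
    ¬ ∀ l, l.IsChain (FamilyExtends G N) → g l ∈ N j := by
  intro hN
  -- The label appended to a sequence is the `g`-image of the path leading to it. Each new image
  -- vertex extends that path inside `N j`, so the labels keep descending.
  let next : List (Option (J × List V)) → Option (J × List V) :=
    fun l => some (j, mapSuffixes g l)
  let l : ℕ → List (Option (J × List V)) :=
    fun n => (fun l => next l :: l)^[n] [none]
  have hl : ∀ n, l (n + 1) = next (l n) :: l n :=
    fun n => Function.iterate_succ_apply' (fun l => next l :: l) n _
  have hext : ∀ n, (l (n + 1)).IsChain (FamilyExtends G N) →
      FamilyExtends G N (next (l (n + 1))) (next (l n)) := fun n hc => by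
    refine ⟨rfl, ⟨g (l (n + 1)), ?_⟩, isChain_mapSuffixes hadj _, nodup_mapSuffixes hinj _,
      fun x hx => ?_⟩
    · rw [hl]
      rfl
    · obtain ⟨l', h1, rfl⟩ := mem_mapSuffixes hx
      exact hN _ (hc.suffix h1)
  have hchain : ∀ n, (l (n + 1)).IsChain (FamilyExtends G N) := fun n => by
    induction n with
    | zero => exact List.isChain_cons_cons.2 ⟨trivial, List.isChain_singleton _⟩
    | succ n ih =>
      have h2 := hext n ih
      rw [hl (n + 1)]
      rw [hl n] at h2 ih ⊢
      exact List.isChain_cons_cons.2 ⟨h2, ih⟩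
  exact FamilyExtends.not_descending h (fun n => next (l n)) fun n => hext n (hchain n)

/-- No family of `κ` graphs of cardinality `κ` in `OneRay` is cofinal. -/
theorem succ_le_weakComplexity {κ : Cardinal.{u}} (hκ : ℵ₀ ≤ κ) :
    Order.succ κ ≤ GraphClass.weakComplexity OneRay κ := by
  obtain ⟨J, G, hJ, hdom⟩ := OneRay.exists_family_of_weakComplexity κ
  rw [← hJ, Order.succ_le_iff]
  by_contra! hJκ
  -- The edgeless graph must embed somewhere; nonemptiness is needed for `#K = κ`.
  have hJ0 : Nonempty J := by
    obtain ⟨j, -⟩ := hdom κ.out ⊥ (mk_out κ) fun v R => ((R.vertex 0).2 : False).elim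
    exact ⟨j⟩
  choose ρ hρ using fun j => (G j).2.exists_common_tail
  let K := J × κ.out × ℕ
  let N : K → Set κ.out := fun k => {x | (G k.1).1.Adj k.2.1 x ∧ ∀ n, x ≠ ρ k.1 k.2.1 (k.2.2 + n)}
  have hN : ∀ k : K, RaylessOn (G k.1).1 (N k) := fun k f hf hadj hfN => by
    obtain ⟨m, m', h⟩ := hρ k.1 k.2.1 f hf hadj fun n => (hfN n).1
    exact (hfN (m + k.2.2)).2 m' (by rw [h, add_comm])
  let r := FamilyExtends (fun k : K => (G k.1).1) N
  have hr := FamilyExtends.not_descending (G := fun k : K => (G k.1).1) hN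
  let L := Option (K × List κ.out)
  have : Infinite κ.out := infinite_iff.2 (by rwa [mk_out])
  have hK : #K = κ := by
    simp only [K, mk_prod, lift_uzero, mk_out, mk_nat, lift_aleph0]
    rw [mul_aleph0_eq hκ, lift_id, lift_id, mul_eq_right hκ hJκ (mk_ne_zero J)]
  have hL : #L = κ := by
    simp only [L, mk_option, mk_prod, lift_id, hK, mk_list_eq_mk, mk_out]
    rw [mul_eq_self hκ, add_one_eq hκ]
  have : Infinite L := infinite_iff.2 (by rwa [hL])
  obtain ⟨j, ⟨φ⟩⟩ := hdom (List L ⊕ PUnit.{u + 1})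
    (apexGraph fun _ => decreasingOrConstant r none)
    (by rw [mk_sum, lift_id, lift_id, mk_list_eq_mk, hL, mk_punit, add_one_eq hκ])
    (oneRay_decreasing hr none)
  have hadj : ∀ l ∈ decreasingOrConstant r (none : L), (G j).1.Adj (φ (.inr ⟨⟩)) (φ (.inl l)) :=
    fun l hl => φ.toHom.map_adj (apexGraph_adj_inr_inl.2 hl)
  have htree : ∀ l l' : List L, TreeAdj l l' → (G j).1.Adj (φ (.inl l)) (φ (.inl l')) :=
    fun l l' hl => φ.toHom.map_adj (apexGraph_adj_inl_inl.2 hl)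
  have hinj : ∀ l l' : List L, φ (.inl l) = φ (.inl l') → l = l' :=
    fun l l' hl => Sum.inl_injective (φ.injective hl)
  -- The constant branch agrees with `ρ` from `m'` on, so by injectivity a decreasing sequence
  -- meeting that tail would equal a constant sequence of length at least two. This would require `r
  -- none none`, which is false.
  obtain ⟨m, m', hm⟩ := hρ j (φ (.inr ⟨⟩)) (fun n => φ (.inl (List.replicate (n + 2) none)))
    (fun a b hab => by simpa using congrArg List.length (hinj _ _ hab))
    (fun n => htree _ _ (Or.inl ⟨none, rfl⟩)) fun n => hadj _ (Or.inr ⟨n, rfl⟩)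
  refine not_mapsTo_decreasing (G := fun k : K => (G k.1).1) hN (j, φ (.inr ⟨⟩), m')
    (fun l => φ (.inl l)) hinj htree fun l hl => ⟨hadj l (Or.inl hl), fun n hn => ?_⟩
  have hl' : List.IsChain r (List.replicate (m + n + 2) none) :=
    hinj _ _ (hn.trans (hm n).symm) ▸ hl
  exact (List.isChain_cons_cons.1 hl').1

/-! ### Regular cardinals and closing off under an embedding -/

theorem bddAbove_of_mk_lt_of_isRegular {κ : Cardinal.{u}} (hκ : κ.IsRegular) (s : Set κ.ord.ToType)
    (hs : #s < κ) : BddAbove s := by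
  have : NoMaxOrder κ.ord.ToType := noMaxOrder hκ.aleph0_le
  by_contra h
  have hcof : IsCofinal s := fun a => by
    by_contra! hc
    exact h ⟨a, fun b hb => (hc b hb).le⟩
  refine (Order.cof_le hcof).not_gt ?_
  rwa [Ordinal.cof_toType, hκ.cof_ord]

theorem mk_Iic_toType_ord_lt {κ : Cardinal.{u}} (hκ : ℵ₀ ≤ κ) (a : κ.ord.ToType) :
    #(Set.Iic a) < κ := by
  have : NoMaxOrder κ.ord.ToType := noMaxOrder hκ
  obtain ⟨b, hb⟩ := exists_gt a
  have hlt := mk_Iio_lt b (by rw [mk_ord_toType, Ordinal.type_toType])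
  rw [mk_ord_toType] at hlt
  exact (mk_le_mk_of_subset fun _ hx => lt_of_le_of_lt hx hb).trans_lt hlt

/-- Club guessing for regular cardinals above `ℵ₁`. -/
theorem exists_club_guessing_of_isRegular {κ : Cardinal.{u}} (hreg : κ.IsRegular)
    (hκ : ℵ_ 1 < κ) : ∃ c : κ.ord.ToType → ℕ → κ.ord.ToType, (∀ i, StrictMono (c i)) ∧
      ∀ g : κ.ord.ToType → κ.ord.ToType, ∃ i, ∀ n, ClosedUnder g (c i n) := by
  have h1 : (ℵ_ 1 : Cardinal.{u}).IsRegular := isRegular_aleph_one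
  have : NoMaxOrder κ.ord.ToType := noMaxOrder hreg.aleph0_le
  have : NoMaxOrder (ℵ_ 1 : Cardinal.{u}).ord.ToType := noMaxOrder h1.aleph0_le
  have : Nonempty (ℵ_ 1 : Cardinal.{u}).ord.ToType := by
    rw [← mk_ne_zero_iff, mk_ord_toType]
    exact h1.pos.ne'
  have h01 : (ℵ₀ : Cardinal.{u}) < ℵ_ 1 := aleph0_lt_aleph_one
  refine exists_club_guessing (B := (ℵ_ 1 : Cardinal.{u}).ord.ToType) ?_ (fun a => ?_)
    (fun s hs => ?_) ?_ fun f => ?_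
  · rw [mk_ord_toType]
    exact h01.trans hκ
  · rw [mk_ord_toType]
    exact mk_Iic_toType_ord_lt hreg.aleph0_le a
  · rw [mk_ord_toType] at hs
    exact bddAbove_of_mk_lt_of_isRegular hreg s hs
  · rwa [mk_ord_toType, mk_ord_toType]
  · exact bddAbove_of_mk_lt_of_isRegular h1 _ ((Set.countable_range f).le_aleph0.trans_lt h01)

/-- There is a function `g` such that below each point closed under `g`, an injection `w` of the
finite sequences neither leaves nor enters the sequences with entries below that point. -/
theorem exists_closing_function {κ : Cardinal.{u}} (hreg : κ.IsRegular) (h0 : ℵ₀ < κ)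
    (w : List κ.ord.ToType → κ.ord.ToType) (hw : Function.Injective w) :
    ∃ g : κ.ord.ToType → κ.ord.ToType, ∀ δ, ClosedUnder g δ →
      ∀ a l, (∀ x ∈ a :: l, x < δ) ↔ w (a :: l) < δ := by
  have : NoMaxOrder κ.ord.ToType := noMaxOrder hreg.aleph0_le
  -- The value at `a` bounds the codes of all sequences with entries up to `a`, and all entries of
  -- the sequence coded by `a`, if any. Sequences are nonempty in the conclusion so that a largest
  -- entry exists.
  have hg : ∀ a, ∃ b, (∀ l : List (Set.Iic a), w (l.map (↑)) ≤ b) ∧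
      ∀ l, w l = a → ∀ x ∈ l, x ≤ b := fun a => by
    obtain ⟨b, hb⟩ := bddAbove_of_mk_lt_of_isRegular hreg
      (Set.range fun l : List (Set.Iic a) => w (l.map (↑))) (mk_range_le.trans_lt
        ((mk_list_le_max _).trans_lt (max_lt h0 (mk_Iic_toType_ord_lt hreg.aleph0_le a))))
    have hb' : ∃ b', ∀ l, w l = a → ∀ x ∈ l, x ≤ b' := by
      by_cases h : ∃ l, w l = a
      · obtain ⟨l, hl⟩ := h
        have : Nonempty κ.ord.ToType := ⟨a⟩
        obtain ⟨b', hb'⟩ := (List.finite_toSet l).bddAbove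
        exact ⟨b', fun l' hl' x hx => hb' (hw (hl'.trans hl.symm) ▸ hx)⟩
      · exact ⟨a, fun l hl => absurd ⟨l, hl⟩ h⟩
    obtain ⟨b', hb'⟩ := hb'
    exact ⟨max b b', fun l => (hb ⟨l, rfl⟩).trans (le_max_left _ _), fun l hl x hx =>
      (hb' l hl x hx).trans (le_max_right _ _)⟩
  choose g hg1 hg2 using hg
  refine ⟨g, fun δ hδ a l => ⟨fun h => ?_, fun h x hx =>
    (hg2 _ _ rfl x hx).trans_lt (hδ _ h)⟩⟩
  obtain ⟨m, hm, hmax⟩ := Set.exists_max_image {x | x ∈ a :: l} id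
    (List.finite_toSet _) ⟨a, List.mem_cons_self⟩
  have hlift : ∃ l' : List (Set.Iic m), l'.map (↑) = a :: l :=
    ⟨(a :: l).attach.map fun x => ⟨x.1, hmax x.1 x.2⟩, by simp⟩
  obtain ⟨l', hl'⟩ := hlift
  have := hg1 m l'
  rw [hl'] at this
  exact this.trans_lt (hδ m (h m hm))

/-! ### The bound `2 ^ ℵ₀`: coding reals -/

/-- The subsequence of `c` that codes a sequence of bits, each of them infinitely often. -/
def codedSubsequence {A : Type u} (c : ℕ → A) (x : ℕ → Bool) (n : ℕ) : A :=
  c (2 * n + if x n.unpair.1 then 1 else 0)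

theorem codedSubsequence_lt {A : Type u} [Preorder A] {c : ℕ → A} (hc : StrictMono c)
    (x : ℕ → Bool) {k n : ℕ} (hk : k < n) : codedSubsequence c x k < c (2 * n) :=
  hc (by split <;> omega)

/-- For regular `κ > ℵ₁`, fewer than `2 ^ ℵ₀` graphs are not cofinal if `κ < 2 ^ ℵ₀`. -/
theorem two_power_aleph0_le_weakComplexity {κ : Cardinal.{u}} (hreg : κ.IsRegular)
    (hκ : ℵ_ 1 < κ) (hκ2 : κ < 2 ^ (ℵ₀ : Cardinal.{u})) :
    2 ^ (ℵ₀ : Cardinal.{u}) ≤ GraphClass.weakComplexity OneRay κ := by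
  have h0 : ℵ₀ < κ := aleph0_lt_aleph_one.trans hκ
  obtain ⟨J, G, hJ, hdom⟩ := OneRay.exists_family_of_weakComplexity κ
  rw [← hJ]
  by_contra! hJlt
  obtain ⟨c, hc, hguess⟩ := exists_club_guessing_of_isRegular hreg hκ
  choose ρ hρ using fun j => (G j).2.exists_common_tail
  obtain ⟨e⟩ : Nonempty (κ.out ≃ κ.ord.ToType) := Cardinal.eq.1 (by rw [mk_out, mk_ord_toType])
  have : Infinite κ.ord.ToType := infinite_iff.2 (by rw [mk_ord_toType]; exact h0.le)
  let K := J × κ.ord.ToType × κ.out × ℕ × ℕ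
  -- Entry `n` of the coded sequence is `c (2n)` or `c (2n + 1)`, and earlier entries lie below `c
  -- (2n)`. So the first `n + 1` entries all lie below `c (2n + 1)` exactly when the bit is `false`.
  have key : ∀ x : ℕ → Bool, ∃ k : K, ∀ n, x (k.2.2.2.1 + n).unpair.1 = false ↔
      e (ρ k.1 k.2.2.1 (k.2.2.2.2 + n)) < c k.2.1 (2 * (k.2.2.2.1 + n) + 1) := fun x => by
    obtain ⟨j, ⟨φ⟩⟩ := hdom (List κ.ord.ToType ⊕ κ.ord.ToType)
      (branchGraph fun i => codedSubsequence (c i) x)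
      (by rw [mk_sum, lift_id, lift_id, mk_list_eq_mk, mk_ord_toType, add_eq_self h0.le])
      (oneRay_branchGraph _)
    obtain ⟨g, hg⟩ := exists_closing_function hreg h0 (fun l => e (φ (.inl l)))
      fun l l' hl => Sum.inl_injective (φ.injective (e.injective hl))
    obtain ⟨i, hi⟩ := hguess g
    let s := codedSubsequence (c i) x
    obtain ⟨m, m', hm⟩ := hρ j (φ (.inr i)) (fun n => φ (.inl (prefixes s (n + 1))))
      (fun a b hab => by
        have := congrArg List.length (Sum.inl_injective (φ.injective hab))
        simpa [length_prefixes] using this)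
      (fun n => φ.toHom.map_adj (apexGraph_adj_inl_inl.2 (Or.inl ⟨s (n + 1), rfl⟩)))
      fun n => φ.toHom.map_adj (apexGraph_adj_inr_inl.2 ⟨n + 1, rfl⟩)
    refine ⟨(j, i, φ (.inr i), m, m'), fun n => ?_⟩
    dsimp only
    rw [← hm n]
    refine Iff.trans ?_ (hg _ (hi (2 * (m + n) + 1)) (s (m + n)) (prefixes s (m + n)))
    constructor
    · intro hx y hy
      obtain ⟨k, hk, rfl⟩ := mem_prefixes (n := m + n + 1) hy
      rcases Nat.lt_succ_iff_lt_or_eq.1 hk with hk | rfl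
      · exact (codedSubsequence_lt (hc i) x hk).trans (hc i (Nat.lt_succ_self _))
      · exact hc i (by simp [hx])
    · intro h
      have := (hc i).lt_iff_lt.1 (h _ List.mem_cons_self)
      by_contra hx
      simp [hx] at this
  choose k hk using key
  have hkinj : Function.Injective k := fun x y hxy => by
    funext a
    -- Only positions past the shift are visible. Bit `a` recurs at `Nat.pair a m`, which is at
    -- least the shift `m`.
    have hx := hk x (Nat.pair a (k x).2.2.2.1 - (k x).2.2.2.1)
    have hy := hk y (Nat.pair a (k x).2.2.2.1 - (k x).2.2.2.1)
    rw [← hxy] at hy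
    rw [Nat.add_sub_cancel' (Nat.right_le_pair _ _), Nat.unpair_pair] at hx hy
    have := hx.trans hy.symm
    cases hxa : x a <;> cases hya : y a <;> simp_all
  have hle := mk_le_of_injective (f := fun x : ULift.{u} (ℕ → Bool) => k x.down)
    (hkinj.comp ULift.down_injective)
  have hK : #K < 2 ^ (ℵ₀ : Cardinal.{u}) := by
    have h2 : (ℵ₀ : Cardinal.{u}) ≤ 2 ^ (ℵ₀ : Cardinal.{u}) := (cantor _).le
    simp only [K, mk_prod, lift_uzero, mk_out, mk_ord_toType, mk_nat, lift_aleph0,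
      aleph0_mul_aleph0, lift_id]
    exact mul_lt_of_lt h2 hJlt (mul_lt_of_lt h2 hκ2 (mul_lt_of_lt h2 hκ2 (cantor _)))
  refine hle.not_gt (hK.trans_eq ?_)
  simp

end UncountableGraphs

theorem corollary1p9 (κ : Cardinal.{u}) (hreg : κ.IsRegular) (hκ : ℵ_ 1 < κ) :
    max (Order.succ κ) (2 ^ (ℵ₀ : Cardinal.{u})) ≤
      UncountableGraphs.GraphClass.weakComplexity UncountableGraphs.OneRay κ := by
  have h := UncountableGraphs.succ_le_weakComplexity hreg.aleph0_le
  refine max_le h ?_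
  rcases lt_or_ge κ (2 ^ (ℵ₀ : Cardinal.{u})) with h2 | h2
  · exact UncountableGraphs.two_power_aleph0_le_weakComplexity hreg hκ h2
  · exact h2.trans ((Order.le_succ κ).trans h)
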